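/- Let $p$ be a prime and let $(F,\theta)$ be a field of characteristic $p$ with an $m$-variate iterative derivation, i.e. a ring homomorphism $\theta:F\to F[[T_1,\dots,T_m]]$, $\theta(a)=\sum_{\mathbf k}\theta^{(\mathbf k)}(a)\mathbf T^{\mathbf k}$, with $\theta^{(\mathbf 0)}=\mathrm{id}$ and $\theta^{(\mathbf i)}\circ\theta^{(\mathbf j)}=\binom{\mathbf i+\mathbf j}{\mathbf i}\theta^{(\mathbf i+\mathbf j)}$. Assume that $\theta$ is non-degenerate (the derivations $\theta^{(1,0,\dots,0)},\dots,\theta^{(0,\dots,0,1)}$ are $F$-linearly independent) and that the field of constants $K=\{a\in F\mid\theta(a)=a\}$ is perfect. An iterative differential equation is an equation $\theta(\mathbf y)=A\mathbf y$ with $A=\sum_{\mathbf k}A_{\mathbf k}\mathbf T^{\mathbf k}\in\mathrm{GL}_n(F[[\mathbf T]])$, $A_{\mathbf 0}=1$ and $\binom{\mathbf k+\mathbf l}{\mathbf l}A_{\mathbf k+\mathbf l}=\sum_{\mathbf i+\mathbf j=\mathbf l}\theta^{(\mathbf i)}(A_{\mathbf k})A_{\mathbf j}$ for all $\mathbf k,\mathbf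 l$. A PPV-ring for it is a commutative $F$-algebra $R$ with an iterative derivation extending $\theta$ (again written $\theta$) such that: $R\neq 0$ and the only ideals of $R$ stable under all $\theta^{(\mathbf k)}$ are $0$ and $R$; there is $Y\in\mathrm{GL}_n(R)$ with $\theta(Y)=AY$ such that $R$ is generated as an $F$-algebra by the entries of $Y$ and $\det(Y)^{-1}$; and the constants of $R$ are exactly those of $F$. The field of fractions $E$ of $R$ is then called a PPV-extension of $F$. Its Galois group scheme $\mathcal G$ is the affine group scheme over $K$ representing the functor $L\mapsto\mathrm{Aut}^{\mathrm{ID}}(R\otimes_KL/F\otimes_KL)$ on commutative $K$-algebras, where $L$ carries the trivial iterative derivation and $\mathrm{Aut}^{\mathrm{ID}}$ denotes the automorphisms that fix $F\otimes_KL$ and commute with all $\theta^{(\mathbf k)}\otimes\mathrm{id}_L$. Write $K[\mathcal G]$ for its coordinate Hopf algebra and $K[\mathcal G]^+$ for the kernel of the counit. One calls $\mathcal G$ infinitesimal if $K[\mathcal G]$ is finite-dimensional over $K$ and the ideal $K[\mathcal G]^+$ is nilpotent. Let $E/F$ be a PPV-extension as above. Then the Galois group scheme $\mathcal G$ exists and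 is of finite type over $K$, and $E/F$ is purely inseparable if and only if $\mathcal G$ is infinitesimal. In this case the exponent of $E/F$, i.e. the minimal $e\in\mathbb N$ such that $E^{p^e}\subseteq F$, exists, and it equals the height of $\mathcal G$, i.e. the minimal $h\in\mathbb N$ such that $x^{p^h}=0$ for all $x\in K[\mathcal G]^+$. (Here $0\in\mathbb N$.) -/

import Mathlib

open scoped TensorProduct

universe u

noncomputable section

/-- The multi-index binomial coefficient `∏ μ, (i μ + j μ choose i μ)`. -/
def multiBinom {m : ℕ} (i j : Fin m →₀ ℕ) : ℕ :=
  ∏ μ, (i μ + j μ).choose (i μ)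

/-- An `m`-variate iterative derivation on a commutative ring `R`: a ring homomorphism
`θ : R → R[[T₁, …, Tₘ]]`, `θ r = ∑ₖ θ⁽ᵏ⁾(r) Tᵏ`, with `θ⁽⁰⁾ = id` and
`θ⁽ⁱ⁾ ∘ θ⁽ʲ⁾ = (i + j choose i) θ⁽ⁱ⁺ʲ⁾`. -/
structure IterativeDerivation (m : ℕ) (R : Type u) [CommRing R] where
  toRingHom : R →+* MvPowerSeries (Fin m) R
  coeff_zero : ∀ r, MvPowerSeries.coeff 0 (toRingHom r) = r
  iterate : ∀ (i j : Fin m →₀ ℕ) (r : R),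
    MvPowerSeries.coeff i (toRingHom (MvPowerSeries.coeff j (toRingHom r))) =
      multiBinom i j • MvPowerSeries.coeff (i + j) (toRingHom r)

namespace IterativeDerivation

variable {m : ℕ} {R : Type u} [CommRing R]

/-- The additive map `θ⁽ᵏ⁾ : R → R`. -/
def component (θ : IterativeDerivation m R) (k : Fin m →₀ ℕ) : R →+ R where
  toFun r := MvPowerSeries.coeff k (θ.toRingHom r)
  map_zero' := by simp
  map_add' := by simp

/-- `r` is a constant: `θ r = r`, the right-hand side being a constant power series. -/
def IsConstant (θ : IterativeDerivation m R) (r : R) : Prop :=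
  θ.toRingHom r = MvPowerSeries.C r

/-- `θ` is non-degenerate: the additive maps (in fact derivations) `θ⁽ᵉⁱ⁾`, `eᵢ` the `i`-th unit
multi-index, are linearly independent over `R`. -/
def NonDegenerate (θ : IterativeDerivation m R) : Prop :=
  LinearIndependent R fun i : Fin m => (θ.component (Finsupp.single i 1) : R → R)

/-- `R` is ID-simple: it is nonzero and its only ID-ideals are the trivial ones. -/
def IsSimple (θ : IterativeDerivation m R) : Prop :=
  Nontrivial R ∧
    ∀ I : Ideal R, (∀ r ∈ I, ∀ k, θ.component k r ∈ I) → I = ⊥ ∨ I = ⊤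

/-- The field of constants `C_F` of an ID-field `F`. -/
def constants {F : Type u} [Field F] (θ : IterativeDerivation m F) : Subfield F where
  carrier := {a | θ.IsConstant a}
  mul_mem' := by
    intro a b ha hb
    simp only [Set.mem_ofPred_eq, IsConstant, map_mul] at *
    rw [ha, hb]
  one_mem' := by simp [IsConstant]
  add_mem' := by
    intro a b ha hb
    simp only [Set.mem_ofPred_eq, IsConstant, map_add] at *
    rw [ha, hb]
  zero_mem' := by simp [IsConstant]
  neg_mem' := by
    intro a ha
    simp only [Set.mem_ofPred_eq, IsConstant, map_neg] at *
    rw [ha]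
  inv_mem' := by
    intro a ha
    simp only [Set.mem_ofPred_eq, IsConstant] at *
    rcases eq_or_ne a 0 with rfl | h
    · simp
    · have h1 : θ.toRingHom a⁻¹ * MvPowerSeries.C a = 1 := by
        rw [← ha, ← map_mul, inv_mul_cancel₀ h, map_one]
      have h2 : (MvPowerSeries.C a : MvPowerSeries (Fin m) F) * MvPowerSeries.C a⁻¹ = 1 := by
        rw [← map_mul, mul_inv_cancel₀ h, map_one]
      exact left_inv_eq_right_inv h1 h2

end IterativeDerivation

/-- An iterative derivation on an `F`-algebra `R` extending the iterative derivation `θ` of `F`,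
so that `R` is an ID-ring over the ID-field `F`. -/
structure IDExtension {m : ℕ} {F : Type u} [Field F] (θ : IterativeDerivation m F)
    (R : Type u) [CommRing R] [Algebra F R] extends IterativeDerivation m R where
  component_algebraMap : ∀ (k : Fin m →₀ ℕ) (a : F),
    toIterativeDerivation.component k (algebraMap F R a) = algebraMap F R (θ.component k a)

/-- An iterative differential equation `θ(y) = A y` of size `n` over the ID-field `(F, θ)`:
a matrix `A = ∑ₖ Aₖ Tᵏ ∈ GLₙ(F[[T]])` with `A₀ = 1` and
`(k + l choose l) A_{k+l} = ∑_{i+j=l} θ⁽ⁱ⁾(Aₖ) Aⱼ`. -/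
structure IDE {m : ℕ} {F : Type u} [Field F] (θ : IterativeDerivation m F) (n : ℕ) where
  mat : GL (Fin n) (MvPowerSeries (Fin m) F)
  coeff_zero : mat.val.map (MvPowerSeries.coeff (R := F) (0 : Fin m →₀ ℕ)) = 1
  cocycle : ∀ k l : Fin m →₀ ℕ,
    multiBinom l k • mat.val.map (MvPowerSeries.coeff (R := F) (k + l)) =
      ∑ ij ∈ Finset.HasAntidiagonal.antidiagonal l,
        (mat.val.map (MvPowerSeries.coeff (R := F) k)).map (θ.component ij.1) *
          mat.val.map (MvPowerSeries.coeff (R := F) ij.2)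

namespace IDExtension

variable {m : ℕ} {F : Type u} [Field F] {θ : IterativeDerivation m F}
  {R : Type u} [CommRing R] [Algebra F R]

/-- `Y ∈ GLₙ(R)` is a fundamental solution matrix: `θ(Y) = A Y`, an identity of matrices over
`R[[T]]` in which `A` and `Y` are regarded as matrices of power series over `R`. -/
def IsFundamental (θR : IDExtension θ R) {n : ℕ} (A : IDE θ n) (Y : GL (Fin n) R) : Prop :=
  Y.val.map θR.toRingHom =
    A.mat.val.map (MvPowerSeries.map (algebraMap F R)) *
      Y.val.map (MvPowerSeries.C : R →+* MvPowerSeries (Fin m) R)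

/-- `R` is a pseudo Picard-Vessiot ring for the equation `θ(y) = A y`. -/
structure IsPPVRing (θR : IDExtension θ R) {n : ℕ} (A : IDE θ n) : Prop where
  simple : θR.toIterativeDerivation.IsSimple
  exists_fundamental : ∃ Y : GL (Fin n) R, θR.IsFundamental A Y ∧
    Algebra.adjoin F (Set.range (fun ij : Fin n × Fin n => Y.val ij.1 ij.2) ∪
      {((Matrix.GeneralLinearGroup.det Y)⁻¹ : Rˣ).val}) = ⊤
  constants_eq : {r : R | θR.toIterativeDerivation.IsConstant r} =
    algebraMap F R '' {a : F | θ.IsConstant a}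

/-- `θ⁽ᵏ⁾` on `R` is linear over the constants `K = C_F`. -/
def componentLinear (θR : IDExtension θ R) (k : Fin m →₀ ℕ) : R →ₗ[θ.constants] R where
  toFun := θR.component k
  map_add' := map_add _
  map_smul' := by
    intro c r
    have hc : θR.toRingHom (algebraMap F R c) = MvPowerSeries.C (algebraMap F R c) := by
      ext j
      have h1 := θR.component_algebraMap j (c : F)
      have h2 : θ.toRingHom (c : F) = MvPowerSeries.C (c : F) := c.2
      have h3 : θ.component j (c : F) = MvPowerSeries.coeff j (MvPowerSeries.C (c : F)) := by
        rw [← h2]; rfl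
      change θR.component j _ = _
      classical
      rw [h1, h3, MvPowerSeries.coeff_C, MvPowerSeries.coeff_C]
      split_ifs <;> simp
    have hs : ∀ s : R, c • s = algebraMap F R c * s := fun s => by
      rw [← Algebra.smul_def]; rfl
    change MvPowerSeries.coeff k (θR.toRingHom (c • r)) =
      c • MvPowerSeries.coeff k (θR.toRingHom r)
    rw [hs, hs, map_mul, hc, MvPowerSeries.coeff_C_mul]

/-- `θ⁽ᵏ⁾` on `R ⊗_K L`, where `L` carries the trivial iterative derivation:
`r ⊗ l ↦ θ⁽ᵏ⁾(r) ⊗ l`. -/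
def componentTensor (θR : IDExtension θ R) (L : Type u) [CommRing L] [Algebra θ.constants L]
    (k : Fin m →₀ ℕ) : R ⊗[θ.constants] L →ₗ[θ.constants] R ⊗[θ.constants] L :=
  (θR.componentLinear k).rTensor L

/-- The group `Aut^ID(R ⊗_K L / F ⊗_K L)` of those automorphisms of `R ⊗_K L` which fix
(the image of) `F ⊗_K L` and commute with the iterative derivation. -/
def autID (θR : IDExtension θ R) (L : Type u) [CommRing L] [Algebra θ.constants L] :
    Subgroup ((R ⊗[θ.constants] L) ≃ₐ[θ.constants] (R ⊗[θ.constants] L)) where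
  carrier := {φ |
    (∀ (a : F) (l : L),
      φ (algebraMap F R a ⊗ₜ[θ.constants] l) = algebraMap F R a ⊗ₜ[θ.constants] l) ∧
    ∀ k x, φ (θR.componentTensor L k x) = θR.componentTensor L k (φ x)}
  mul_mem' := by
    rintro φ ψ ⟨h1, h2⟩ ⟨h3, h4⟩
    exact ⟨fun a l => by simp [h1, h3], fun k x => by simp [h2, h4]⟩
  one_mem' := ⟨fun _ _ => rfl, fun _ _ => rfl⟩
  inv_mem' := by
    rintro φ ⟨h1, h2⟩
    refine ⟨fun a l => ?_, fun k x => ?_⟩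
    · exact (AlgEquiv.symm_apply_eq φ).2 (h1 a l).symm
    · refine (AlgEquiv.symm_apply_eq φ).2 ?_
      rw [h2]
      exact congrArg _ (AlgEquiv.apply_symm_apply φ x).symm

/-- The commutative Hopf algebra `H` over `K = C_F` represents the group functor
`L ↦ Aut^ID(R ⊗_K L / F ⊗_K L)` on commutative `K`-algebras, i.e. `Spec H` is the Galois group
scheme of `R` over `F` and `H` is its coordinate ring. The datum is a group isomorphism
`Hom_K(H, L) ≅ Aut^ID(R ⊗_K L / F ⊗_K L)` for every `L` (convolution on the left, composition on
the right), natural in `L`. For `f : L → L'`, the functor sends `φ` to its base change `φ'` along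
`f`, which is the unique element of the target group with `(id ⊗ f) ∘ φ = φ' ∘ (id ⊗ f)`. -/
structure GaloisGroupScheme (θR : IDExtension θ R) (H : Type u) [CommRing H]
    [HopfAlgebra θ.constants H] where
  equiv : ∀ (L : Type u) [CommRing L] [Algebra θ.constants L],
    WithConv (H →ₐ[θ.constants] L) ≃* θR.autID L
  natural : ∀ (L L' : Type u) [CommRing L] [Algebra θ.constants L] [CommRing L']
    [Algebra θ.constants L'] (f : L →ₐ[θ.constants] L') (g : H →ₐ[θ.constants] L)
    (x : R ⊗[θ.constants] L),
    Algebra.TensorProduct.map (AlgHom.id θ.constants R) f ((equiv L (WithConv.toConv g)).val x) =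
      (equiv L' (WithConv.toConv (f.comp g))).val
        (Algebra.TensorProduct.map (AlgHom.id θ.constants R) f x)

end IDExtension

/-- The augmentation ideal of a Hopf algebra: the kernel of the counit. -/
def augmentationIdeal (K H : Type u) [Field K] [CommRing H] [HopfAlgebra K H] : Ideal H :=
  RingHom.ker (Bialgebra.counitAlgHom K H)

/-- The affine group scheme `Spec H` over `K` is infinitesimal: it is finite over `K` and its
augmentation ideal is nilpotent. -/
def IsInfinitesimal (K H : Type u) [Field K] [CommRing H] [HopfAlgebra K H] : Prop :=
  Module.Finite K H ∧ IsNilpotent (augmentationIdeal K H)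

/-- `h` is the height of `Spec H`: the least natural number with `x ^ (p ^ h) = 0` for every
element `x` of the augmentation ideal. -/
def IsHeight (p : ℕ) (K H : Type u) [Field K] [CommRing H] [HopfAlgebra K H] (h : ℕ) : Prop :=
  IsLeast {h : ℕ | ∀ x ∈ augmentationIdeal K H, x ^ p ^ h = 0} h

end

/-! Write `K` for the constants of `F` and `μ : R ⊗[F] R → R` for multiplication. Both `Y ⊗ 1` and
`1 ⊗ Y` solve the same equation, so the quotient `Z = (Y ⊗ 1)⁻¹ (1 ⊗ Y)` has constant entries. Let
`T = K[Z, det Z⁻¹]`. Because `R` is ID-simple with constants `K`, the map `R ⊗[K] T → R ⊗[F] R` is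
an isomorphism (`torsorMap_injective`, `torsorMap_surjective`). Through it a point `T → L` gives an
automorphism of `R ⊗[K] L`, and every ID-automorphism over `F ⊗[K] L` arises exactly once
(`pointAut_bijective`). Yoneda then makes `T` a Hopf algebra of finite type representing the
functor, and any representing `H` is isomorphic to it with counit corresponding to `μ`
(`GaloisGroupScheme.exists_algEquiv`).

For `q = p ^ e`, the statement that all `q`-th powers vanish on the augmentation ideal of `H` and
the statement `R^q ⊆ F` are both equivalent to `z^q = μ(z)^q ⊗ 1` for every `z` in `R ⊗[F] R`
(`pow_eq_zero_iff_pow_mem_range`). The condition on `R` passes to `E` by taking quotients. This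
equivalence, valid for each `e` separately, identifies exponent with height. Finite type supplies a
uniform `e` for a purely inseparable `E`, and turns a uniform `e` on `H` into finiteness and
nilpotence. -/

noncomputable section

/-! ### Yoneda: a Hopf algebra structure from a represented group functor. -/

namespace RepresentedGroup

variable {K H : Type u} [CommRing K] [CommRing H] [Algebra K H]
  {G : ∀ (L : Type u) [CommRing L] [Algebra K L], Type u}
  [∀ (L : Type u) [CommRing L] [Algebra K L], Group (G L)]
  (e : ∀ (L : Type u) [CommRing L] [Algebra K L], (H →ₐ[K] L) ≃ G L)

/-- The multiplication of `H`-points with values in `L`, transported from `G L`. -/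
def mul {L : Type u} [CommRing L] [Algebra K L] (x y : H →ₐ[K] L) : H →ₐ[K] L :=
  (e L).symm (e L x * e L y)

/-- The multiplication of points is compatible with change of the value algebra. -/
def IsNatural : Prop :=
  ∀ (L L' : Type u) [CommRing L] [Algebra K L] [CommRing L'] [Algebra K L']
    (f : L →ₐ[K] L') (x y : H →ₐ[K] L), f.comp (mul e x y) = mul e (f.comp x) (f.comp y)

/-- The neutral `H`-point with values in `L`. -/
def one (L : Type u) [CommRing L] [Algebra K L] : H →ₐ[K] L := (e L).symm 1

section

variable {L : Type u} [CommRing L] [Algebra K L]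

theorem mul_assoc' (x y z : H →ₐ[K] L) : mul e (mul e x y) z = mul e x (mul e y z) := by
  simp [mul, mul_assoc]

theorem one_mul' (x : H →ₐ[K] L) : mul e (one e L) x = x := by simp [mul, one]

theorem mul_one' (x : H →ₐ[K] L) : mul e x (one e L) = x := by simp [mul, one]

/-- Naturality is only assumed for products; characterizing the neutral point as the only idempotent
makes base change preserve it as well. -/
theorem eq_one_of_mul_self (x : H →ₐ[K] L) (h : mul e x x = x) : x = one e L := by
  have : e L x * e L x = e L x := by
    simpa [mul] using congrArg (e L) h
  rw [one, Equiv.eq_symm_apply]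
  simpa using this

end

variable {e} in
theorem IsNatural.comp_one (he : IsNatural e) {L L' : Type u} [CommRing L] [Algebra K L]
    [CommRing L'] [Algebra K L'] (f : L →ₐ[K] L') : f.comp (one e L) = one e L' :=
  eq_one_of_mul_self e _ (by rw [← he, one_mul'])

/-- The comultiplication: the product of the two tautological points in `H ⊗ H`. -/
def comul : H →ₐ[K] H ⊗[K] H :=
  mul e Algebra.TensorProduct.includeLeft Algebra.TensorProduct.includeRight

/-- The inverse of the tautological point. -/
def antipode : H →ₐ[K] H := (e H).symm (e H (AlgHom.id K H))⁻¹

theorem antipode_mul : mul e (antipode e) (AlgHom.id K H) = one e H := by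
  simp [mul, antipode, one]

theorem mul_antipode : mul e (AlgHom.id K H) (antipode e) = one e H := by
  simp [mul, antipode, one]

variable {e} in
theorem IsNatural.comp_comul (he : IsNatural e) {L : Type u} [CommRing L] [Algebra K L]
    (f : H ⊗[K] H →ₐ[K] L) :
    f.comp (comul e) = mul e (f.comp Algebra.TensorProduct.includeLeft)
      (f.comp Algebra.TensorProduct.includeRight) := he _ _ _ _ _

-- By `comp_comul` both sides are products of the three tautological points in `H ⊗ H ⊗ H`,
-- bracketed differently, so associativity of the group suffices.
open Algebra.TensorProduct in
theorem IsNatural.coassoc (he : IsNatural e) :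
    (Algebra.TensorProduct.assoc K K K H H H).toAlgHom.comp
      ((map (comul e) (.id K H)).comp (comul e)) = (map (.id K H) (comul e)).comp (comul e) := by
  set α := (Algebra.TensorProduct.assoc K K K H H H).toAlgHom
  have h1 : (α.comp (map (comul e) (.id K H))).comp includeLeft =
      (α.comp includeLeft).comp (comul e) := by
    ext x; simp
  have h2 : (map (.id K H) (comul e)).comp includeRight = includeRight.comp (comul e) := by
    ext x; simp
  rw [← AlgHom.comp_assoc, he.comp_comul, he.comp_comul, h1, h2, he.comp_comul, he.comp_comul,
    mul_assoc']
  congr 1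
  · ext x; simp [α, one_def]
  congr 1
  ext x
  simp only [AlgHom.comp_apply, includeRight_apply, map_tmul, map_one, AlgHom.id_apply]
  exact TensorProduct.assoc_tmul (R := K) (1 : H) (1 : H) x

variable {e} in
theorem IsNatural.productMap_comp_comul (he : IsNatural e) {L : Type u} [CommRing L]
    [Algebra K L] (x y : H →ₐ[K] L) :
    (Algebra.TensorProduct.productMap x y).comp (comul e) = mul e x y := by
  rw [he.comp_comul, Algebra.TensorProduct.productMap_left,
    Algebra.TensorProduct.productMap_right]

/-- The bialgebra structure on an algebra representing a group functor. -/
abbrev bialgebra (he : IsNatural e) : Bialgebra K H :=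
  Bialgebra.ofAlgHom (comul e) (one e K) (he.coassoc e)
    (by
      have h1 : (Algebra.TensorProduct.map (one e K) (.id K H)).comp
          Algebra.TensorProduct.includeLeft = one e _ := by
        rw [← he.comp_one (Algebra.TensorProduct.includeLeft : K →ₐ[K] K ⊗[K] H)]
        ext x; simp
      rw [he.comp_comul, h1, one_mul']
      ext x; simp)
    (by
      have h1 : (Algebra.TensorProduct.map (.id K H) (one e K)).comp
          Algebra.TensorProduct.includeRight = one e _ := by
        rw [← he.comp_one (Algebra.TensorProduct.includeRight : K →ₐ[K] H ⊗[K] K)]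
        ext x; simp
      rw [he.comp_comul, h1, mul_one']
      ext x; simp)

/-- The Hopf algebra structure on an algebra representing a group functor. -/
abbrev hopfAlgebra (he : IsNatural e) : HopfAlgebra K H where
  __ := bialgebra e he
  antipode := (antipode e).toLinearMap
  mul_antipode_rTensor_comul := by
    have h := he.productMap_comp_comul (antipode e) (AlgHom.id K H)
    rw [antipode_mul, ← he.comp_one (Algebra.ofId K H)] at h
    have h' := congrArg AlgHom.toLinearMap h
    refine Eq.trans ?_ h'
    ext x
    change LinearMap.mul' K H ((antipode e).toLinearMap.rTensor H (comul e x)) =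
      Algebra.TensorProduct.productMap (antipode e) (AlgHom.id K H) (comul e x)
    induction comul e x using TensorProduct.induction_on with
    | zero => simp
    | tmul a b => simp
    | add a b ha hb => simp only [map_add, ha, hb]
  mul_antipode_lTensor_comul := by
    have h := he.productMap_comp_comul (AlgHom.id K H) (antipode e)
    rw [mul_antipode, ← he.comp_one (Algebra.ofId K H)] at h
    have h' := congrArg AlgHom.toLinearMap h
    refine Eq.trans ?_ h'
    ext x
    change LinearMap.mul' K H ((antipode e).toLinearMap.lTensor H (comul e x)) =
      Algebra.TensorProduct.productMap (AlgHom.id K H) (antipode e) (comul e x)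
    induction comul e x using TensorProduct.induction_on with
    | zero => simp
    | tmul a b => simp
    | add a b ha hb => simp only [map_add, ha, hb]

theorem convMul_eq (he : IsNatural e) {L : Type u} [CommRing L] [Algebra K L]
    (x y : H →ₐ[K] L) :
    let := hopfAlgebra e he
    WithConv.toConv x * WithConv.toConv y = WithConv.toConv (mul e x y) := by
  let := hopfAlgebra e he
  rw [← he.productMap_comp_comul]
  ext c
  exact AlgHom.convMul_apply _ _ _

end RepresentedGroup
end

/-! ### Constants and stable submodules of a tensor product. -/

noncomputable section

namespace TensorProduct

variable {K R V κ : Type*} [Field K] [CommRing R] [Algebra K R] [AddCommGroup V] [Module K V]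
  (D : κ → R →ₗ[K] R)

/-- The operators act coordinatewise in a `K`-basis of `V`, which reduces questions about `R ⊗ V` to
`R`. -/
theorem basis_repr_rTensor {ι : Type*} (b : Module.Basis ι K V) (f : R →ₗ[K] R) (x : R ⊗[K] V)
    (i : ι) : (Algebra.TensorProduct.basis R b).repr (f.rTensor V x) i =
      f ((Algebra.TensorProduct.basis R b).repr x i) := by
  induction x using TensorProduct.induction_on with
  | zero => simp
  | tmul r v =>
    simp only [LinearMap.rTensor_tmul, Algebra.TensorProduct.basis_repr_tmul, Finsupp.smul_apply,
      Finsupp.mapRange_apply, smul_eq_mul]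
    rw [mul_comm, mul_comm r, ← _root_.Algebra.smul_def, ← _root_.Algebra.smul_def, map_smul]
  | add x y hx hy => simp [hx, hy]

variable {D}

/-- If the common kernel of the operators `D k` on `R` is `K`, then their common kernel on
`R ⊗ V` is `V`. -/
theorem exists_one_tmul_of_rTensor_eq_zero
    (hD : ∀ r, (∀ k, D k r = 0) → r ∈ Set.range (algebraMap K R))
    {x : R ⊗[K] V} (hx : ∀ k, (D k).rTensor V x = 0) : ∃ v : V, x = 1 ⊗ₜ v := by
  classical
  obtain ⟨ι, b⟩ : Σ ι : Type _, Module.Basis ι K V := ⟨_, Module.Basis.ofVectorSpace K V⟩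
  set B := Algebra.TensorProduct.basis R b
  have h1 : ∀ i, ∃ c : K, algebraMap K R c = B.repr x i := fun i =>
    hD _ fun k => by rw [← basis_repr_rTensor, hx k]; simp
  choose c hc using h1
  refine ⟨∑ i ∈ (B.repr x).support, c i • b i, ?_⟩
  conv_lhs => rw [← B.linearCombination_repr x]
  rw [Finsupp.linearCombination_apply, Finsupp.sum, TensorProduct.tmul_sum]
  refine Finset.sum_congr rfl fun i _ => ?_
  rw [← hc, algebraMap_smul, Algebra.TensorProduct.basis_apply, TensorProduct.tmul_smul]

/-- Over a ring `R` that is simple with respect to the operators `D k`, a stable submodule of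
`R ⊗ V` meeting `V` trivially is zero. -/
theorem eq_bot_of_rTensor_stable
    (hsimple : ∀ I : Ideal R, (∀ r ∈ I, ∀ k, D k r ∈ I) → I = ⊥ ∨ I = ⊤)
    (hone : ∀ k, D k 1 = 0)
    (hD : ∀ r, (∀ k, D k r = 0) → r ∈ Set.range (algebraMap K R))
    (hR : Nontrivial R)
    (N : Submodule R (R ⊗[K] V)) (hN : ∀ x ∈ N, ∀ k, (D k).rTensor V x ∈ N)
    (hV : ∀ v : V, (1 : R) ⊗ₜ[K] v ∈ N → v = 0) : N = ⊥ := by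
  classical
  obtain ⟨ι, b⟩ : Σ ι : Type _, Module.Basis ι K V := ⟨_, Module.Basis.ofVectorSpace K V⟩
  set B := Algebra.TensorProduct.basis R b with hB
  -- Minimal support argument: induction on the number of nonzero coordinates.
  suffices h : ∀ (n : ℕ) (x : R ⊗[K] V), (B.repr x).support.card = n → x ∈ N → x = 0 from
    (Submodule.eq_bot_iff _).2 fun x hx => h _ x rfl hx
  intro n
  induction n using Nat.strong_induction_on with
  | _ n ih =>
  intro x hxn hx
  by_contra hx0
  obtain ⟨i, hi⟩ : ∃ i, B.repr x i ≠ 0 := by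
    by_contra! h
    exact hx0 (B.repr.map_eq_zero_iff.1 (Finsupp.ext h))
  let M : Submodule R (R ⊗[K] V) :=
    N ⊓ (Finsupp.supported R R (B.repr x).support).comap B.repr.toLinearMap
  have hM : ∀ y, y ∈ M ↔ y ∈ N ∧ ∀ j, B.repr x j = 0 → B.repr y j = 0 := fun y => by
    simp only [M, Submodule.mem_inf, Submodule.mem_comap, Finsupp.mem_supported']
    simp
  -- The `i`-th coordinates of elements of `N` supported inside the support of `x` form a stable
  -- ideal, nonzero because of `x`; simplicity yields such an element `y` with `i`-th coordinate
  -- `1`.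
  let I : Ideal R := M.map (B.coord i)
  have hMD : ∀ y ∈ M, ∀ k, (D k).rTensor V y ∈ M := fun y hy k =>
    (hM _).2 ⟨hN _ ((hM _).1 hy).1 k, fun j hj => by
      rw [hB, basis_repr_rTensor, ← hB, ((hM _).1 hy).2 j hj, map_zero]⟩
  have hI : I = ⊤ := by
    refine (hsimple I ?_).resolve_left fun h => hi ?_
    · rintro _ ⟨y, hy, rfl⟩ k
      exact ⟨_, hMD y hy k, by simp [hB, basis_repr_rTensor]⟩
    · have : B.coord i x ∈ I := ⟨x, (hM _).2 ⟨hx, fun _ h => h⟩, rfl⟩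
      rw [h] at this
      simpa using this
  obtain ⟨y, hy, hy1⟩ : (1 : R) ∈ I := hI ▸ Submodule.mem_top
  have hy1 : B.repr y i = 1 := hy1
  -- `D k` kills the coordinate `1`, so the support loses `i` and the induction hypothesis applies.
  -- Hence `y` lies in `V`, where `N` is trivial.
  have hy0 : ∀ k, (D k).rTensor V y = 0 := fun k => by
    have h2 := (hM _).1 (hMD y hy k)
    refine ih _ ?_ _ rfl h2.1
    rw [← hxn]
    refine Finset.card_lt_card ⟨fun j hj => ?_, fun h => ?_⟩
    · rw [Finsupp.mem_support_iff] at hj ⊢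
      exact fun h => hj (h2.2 j h)
    · have := h (Finsupp.mem_support_iff.2 hi)
      rw [Finsupp.mem_support_iff, hB, basis_repr_rTensor, ← hB, hy1, hone] at this
      exact this rfl
  obtain ⟨v, rfl⟩ := exists_one_tmul_of_rTensor_eq_zero hD hy0
  rw [hV v ((hM _).1 hy).1] at hy1
  simp at hy1

end TensorProduct
end

/-! ### The torsor isomorphism `R ⊗[K] T ≅ R ⊗[F] R`. -/

noncomputable section

namespace IDExtension

open Algebra.TensorProduct

variable {m : ℕ} {F : Type u} [Field F] {θ : IterativeDerivation m F}
  {R : Type u} [CommRing R] [Algebra F R] (θR : IDExtension θ R)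

theorem toRingHom_algebraMap (a : F) : θR.toRingHom (algebraMap F R a) =
    MvPowerSeries.map (algebraMap F R) (θ.toRingHom a) := by
  ext k
  rw [MvPowerSeries.coeff_map]
  exact θR.component_algebraMap k a

theorem component_zero (r : R) : θR.component 0 r = r := θR.coeff_zero r

/-- Index `0` must be left out, since `θ⁽⁰⁾` is the identity; the remaining components are the
operators `D k` of the previous part. -/
theorem isConstant_iff (r : R) :
    θR.IsConstant r ↔ ∀ k : {k : Fin m →₀ ℕ // k ≠ 0}, θR.componentLinear k r = 0 := by
  classical
  constructor
  · rintro h ⟨k, hk⟩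
    change MvPowerSeries.coeff k (θR.toRingHom r) = 0
    rw [show θR.toRingHom r = _ from h, MvPowerSeries.coeff_C, if_neg hk]
  · intro h
    refine MvPowerSeries.ext fun k => ?_
    rw [MvPowerSeries.coeff_C]
    split_ifs with hk
    · rw [hk]; exact θR.coeff_zero r
    · exact h ⟨k, hk⟩

theorem componentLinear_one (k : {k : Fin m →₀ ℕ // k ≠ 0}) : θR.componentLinear k (1 : R) = 0 :=
  (θR.isConstant_iff 1).1 (by simp [IterativeDerivation.IsConstant]) k

theorem ideal_eq_bot_or_top (hs : θR.toIterativeDerivation.IsSimple) (I : Ideal R)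
    (hI : ∀ r ∈ I, ∀ k : {k : Fin m →₀ ℕ // k ≠ 0}, θR.componentLinear k r ∈ I) :
    I = ⊥ ∨ I = ⊤ := by
  refine hs.2 I fun r hr k => ?_
  rcases eq_or_ne k 0 with rfl | hk
  · rwa [component_zero]
  · exact hI r hr ⟨k, hk⟩

theorem mem_range_of_componentLinear_eq_zero
    (hc : {r : R | θR.IsConstant r} = algebraMap F R '' {a : F | θ.IsConstant a}) (r : R)
    (hr : ∀ k : {k : Fin m →₀ ℕ // k ≠ 0}, θR.componentLinear k r = 0) :
    r ∈ Set.range (algebraMap θ.constants R) := by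
  have h : r ∈ {r : R | θR.IsConstant r} := (θR.isConstant_iff r).2 hr
  rw [hc] at h
  obtain ⟨a, ha, rfl⟩ := h
  exact ⟨⟨a, ha⟩, rfl⟩

theorem submodule_tensor_eq_bot (hs : θR.toIterativeDerivation.IsSimple)
    (hc : {r : R | θR.IsConstant r} = algebraMap F R '' {a : F | θ.IsConstant a})
    {V : Type*} [AddCommGroup V] [Module θ.constants V] (N : Submodule R (R ⊗[θ.constants] V))
    (hN : ∀ x ∈ N, ∀ k, (θR.componentLinear k).rTensor V x ∈ N)
    (hV : ∀ v : V, (1 : R) ⊗ₜ[θ.constants] v ∈ N → v = 0) : N = ⊥ :=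
  TensorProduct.eq_bot_of_rTensor_stable
    (D := fun k : {k : Fin m →₀ ℕ // k ≠ 0} => θR.componentLinear k)
    (θR.ideal_eq_bot_or_top hs) θR.componentLinear_one
    (θR.mem_range_of_componentLinear_eq_zero hc) hs.1 N (fun x hx k => hN x hx k) hV

theorem exists_one_tmul
    (hc : {r : R | θR.IsConstant r} = algebraMap F R '' {a : F | θ.IsConstant a})
    {V : Type*} [AddCommGroup V] [Module θ.constants V] (x : R ⊗[θ.constants] V)
    (hx : ∀ k ≠ 0, (θR.componentLinear k).rTensor V x = 0) : ∃ v : V, x = 1 ⊗ₜ v :=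
  TensorProduct.exists_one_tmul_of_rTensor_eq_zero
    (D := fun k : {k : Fin m →₀ ℕ // k ≠ 0} => θR.componentLinear k)
    (θR.mem_range_of_componentLinear_eq_zero hc) fun k => hx k k.2

/-- The additive map underlying the iterative derivation of `R ⊗ R`. -/
def tensorSelfAux : R ⊗[F] R →+ MvPowerSeries (Fin m) (R ⊗[F] R) :=
  TensorProduct.liftAddHom
    ((AddMonoidHom.mul.comp
      ((MvPowerSeries.map (includeLeftRingHom : R →+* R ⊗[F] R)).comp
        θR.toRingHom).toAddMonoidHom).compl₂
      ((MvPowerSeries.map (includeRight : R →ₐ[F] R ⊗[F] R).toRingHom).comp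
        θR.toRingHom).toAddMonoidHom)
    (by
      intro a r s
      -- The formula is `F`-balanced because `θ` maps `F` into `F[[T]]`, where the two embeddings
      -- agree.
      have h : ∀ a : F, MvPowerSeries.map (includeLeftRingHom : R →+* R ⊗[F] R)
          (θR.toRingHom (algebraMap F R a)) =
          MvPowerSeries.map (includeRight : R →ₐ[F] R ⊗[F] R).toRingHom
            (θR.toRingHom (algebraMap F R a)) := fun a => by
        rw [toRingHom_algebraMap]
        ext k
        simp [MvPowerSeries.coeff_map]
      set f := (includeLeftRingHom : R →+* R ⊗[F] R)
      set g := (includeRight : R →ₐ[F] R ⊗[F] R).toRingHom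
      change MvPowerSeries.map f (θR.toRingHom (a • r)) * MvPowerSeries.map g (θR.toRingHom s) =
        MvPowerSeries.map f (θR.toRingHom r) * MvPowerSeries.map g (θR.toRingHom (a • s))
      rw [Algebra.smul_def, Algebra.smul_def, map_mul, map_mul, map_mul, map_mul, h]
      ring)

theorem tensorSelfAux_tmul (r s : R) : θR.tensorSelfAux (r ⊗ₜ s) =
    MvPowerSeries.map (includeLeftRingHom : R →+* R ⊗[F] R) (θR.toRingHom r) *
      MvPowerSeries.map (includeRight : R →ₐ[F] R ⊗[F] R).toRingHom (θR.toRingHom s) := rfl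

/-- The iterative derivation of `R ⊗ R`, `θ (r ⊗ s) = θ r ⊗ θ s`, as a ring homomorphism. -/
def tensorSelf : R ⊗[F] R →+* MvPowerSeries (Fin m) (R ⊗[F] R) :=
  { θR.tensorSelfAux with
    map_zero' := map_zero _
    map_one' := by
      change θR.tensorSelfAux (1 ⊗ₜ 1) = 1
      simp [tensorSelfAux_tmul]
    map_mul' := fun x y => by
      change θR.tensorSelfAux (x * y) = θR.tensorSelfAux x * θR.tensorSelfAux y
      induction x using TensorProduct.induction_on with
      | zero => simp
      | add x x' hx hx' => rw [add_mul, map_add, map_add, add_mul, hx, hx']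
      | tmul r s =>
        induction y using TensorProduct.induction_on with
        | zero => simp
        | add y y' hy hy' => rw [mul_add, map_add, map_add, mul_add, hy, hy']
        | tmul r' s' =>
          simp only [tensorSelfAux_tmul, tmul_mul_tmul, map_mul]
          ring }

theorem tensorSelf_tmul (r s : R) : θR.tensorSelf (r ⊗ₜ s) =
    MvPowerSeries.map (includeLeftRingHom : R →+* R ⊗[F] R) (θR.toRingHom r) *
      MvPowerSeries.map (includeRight : R →ₐ[F] R ⊗[F] R).toRingHom (θR.toRingHom s) := rfl

theorem tensorSelf_tmul_one (r : R) : θR.tensorSelf (r ⊗ₜ 1) =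
    MvPowerSeries.map (includeLeftRingHom : R →+* R ⊗[F] R) (θR.toRingHom r) := by
  simp [tensorSelf_tmul]

theorem tensorSelf_one_tmul (r : R) : θR.tensorSelf (1 ⊗ₜ r) =
    MvPowerSeries.map (includeRight : R →ₐ[F] R ⊗[F] R).toRingHom (θR.toRingHom r) := by
  simp [tensorSelf_tmul]

variable {n : ℕ}

/-- The matrix `(Y ⊗ 1)⁻¹ (1 ⊗ Y)`. -/
def torsorMatrix (F : Type u) [Field F] [Algebra F R] (Y : GL (Fin n) R) :
    GL (Fin n) (R ⊗[F] R) :=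
  (Matrix.GeneralLinearGroup.map (includeLeftRingHom : R →+* R ⊗[F] R) Y)⁻¹ *
    Matrix.GeneralLinearGroup.map (includeRight : R →ₐ[F] R ⊗[F] R).toRingHom Y

variable (θ) in
/-- The algebra generated over the constants by the entries of `(Y ⊗ 1)⁻¹ (1 ⊗ Y)` and the inverse
of its determinant. -/
def torsorAlgebra (Y : GL (Fin n) R) : Subalgebra θ.constants (R ⊗[F] R) :=
  Algebra.adjoin θ.constants
    (Set.range (fun ij : Fin n × Fin n => (torsorMatrix F Y).val ij.1 ij.2) ∪
      {((Matrix.GeneralLinearGroup.det (torsorMatrix F Y))⁻¹ : (R ⊗[F] R)ˣ).val})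

instance (Y : GL (Fin n) R) : Algebra.FiniteType θ.constants (torsorAlgebra θ Y) :=
  (Subalgebra.fg_iff_finiteType _).1
    (Subalgebra.fg_def.2 ⟨_, (Set.finite_range _).union (Set.finite_singleton _), rfl⟩)

/-- The torsor map `R ⊗ H → R ⊗ R`, `r ⊗ c ↦ (r ⊗ 1) c`. -/
def torsorMap (H : Subalgebra θ.constants (R ⊗[F] R)) : R ⊗[θ.constants] H →ₐ[R] R ⊗[F] R :=
  Algebra.TensorProduct.lift (Algebra.ofId R _) H.val fun _ _ => .all _ _

theorem torsorMap_tmul (H : Subalgebra θ.constants (R ⊗[F] R)) (r : R) (c : H) :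
    torsorMap H (r ⊗ₜ c) = (r ⊗ₜ 1) * (c : R ⊗[F] R) := rfl

/-- `key` says that `Y ⊗ 1` and `1 ⊗ Y` both solve the equation given by `A`; in the quotient the
factor `A` cancels. -/
theorem tensorSelf_torsorMatrix {θR : IDExtension θ R} {A : IDE θ n} {Y : GL (Fin n) R}
    (hY : θR.IsFundamental A Y) :
    Matrix.GeneralLinearGroup.map θR.tensorSelf (torsorMatrix F Y) =
      Matrix.GeneralLinearGroup.map MvPowerSeries.C (torsorMatrix F Y) := by
  have h0 : Matrix.GeneralLinearGroup.map θR.toRingHom Y =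
      Matrix.GeneralLinearGroup.map (MvPowerSeries.map (algebraMap F R)) A.mat *
        Matrix.GeneralLinearGroup.map MvPowerSeries.C Y := Units.ext hY
  have key : ∀ f : R →+* R ⊗[F] R, (∀ r, θR.tensorSelf (f r) =
      MvPowerSeries.map f (θR.toRingHom r)) → f.comp (algebraMap F R) = algebraMap F (R ⊗[F] R) →
      Matrix.GeneralLinearGroup.map θR.tensorSelf (Matrix.GeneralLinearGroup.map f Y) =
      Matrix.GeneralLinearGroup.map (MvPowerSeries.map (algebraMap F (R ⊗[F] R))) A.mat *
        Matrix.GeneralLinearGroup.map MvPowerSeries.C (Matrix.GeneralLinearGroup.map f Y) := by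
    intro f hf hfF
    have h1 := congrArg (Matrix.GeneralLinearGroup.map (MvPowerSeries.map f)) h0
    rw [map_mul] at h1
    convert h1 using 1
    · ext i j : 2
      exact hf _
    · congr 1
      · ext i j : 2
        change MvPowerSeries.map (algebraMap F (R ⊗[F] R)) _ =
          MvPowerSeries.map f (MvPowerSeries.map (algebraMap F R) _)
        rw [← hfF]
        rfl
      · ext i j : 2
        exact (MvPowerSeries.map_C f _).symm
  rw [torsorMatrix, map_mul, map_mul, map_inv, map_inv,
    key _ θR.tensorSelf_tmul_one (RingHom.ext fun a => rfl),
    key _ θR.tensorSelf_one_tmul (RingHom.ext fun a =>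
      (includeRight : R →ₐ[F] R ⊗[F] R).commutes a)]
  group

theorem tensorSelf_of_mem_torsorAlgebra {θR : IDExtension θ R} {A : IDE θ n} {Y : GL (Fin n) R}
    (hY : θR.IsFundamental A Y) {c : R ⊗[F] R} (hc : c ∈ torsorAlgebra θ Y) :
    θR.tensorSelf c = MvPowerSeries.C c := by
  induction hc using Algebra.adjoin_induction with
  | mem x hx =>
    rcases hx with ⟨ij, rfl⟩ | rfl
    · exact congrArg (fun M : GL (Fin n) _ => M.val ij.1 ij.2) (tensorSelf_torsorMatrix hY)
    · have h := congrArg (fun M => ((Matrix.GeneralLinearGroup.det M)⁻¹).val)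
        (tensorSelf_torsorMatrix hY)
      simp only [Matrix.GeneralLinearGroup.map_det, ← map_inv] at h
      exact h
  | algebraMap a =>
    have h1 : algebraMap θ.constants (R ⊗[F] R) a = algebraMap F R a ⊗ₜ 1 := rfl
    have h2 : θ.toRingHom (a : F) = MvPowerSeries.C (a : F) := a.2
    rw [h1, tensorSelf_tmul_one, toRingHom_algebraMap, h2, MvPowerSeries.map_C,
      MvPowerSeries.map_C]
    rfl
  | add x y _ _ hx hy => rw [map_add, map_add, hx, hy]
  | mul x y _ _ hx hy => rw [map_mul, map_mul, hx, hy]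

theorem coeff_tensorSelf_torsorMap {H : Subalgebra θ.constants (R ⊗[F] R)}
    (hH : ∀ c ∈ H, θR.tensorSelf c = MvPowerSeries.C c) (k : Fin m →₀ ℕ)
    (x : R ⊗[θ.constants] H) : MvPowerSeries.coeff k (θR.tensorSelf (torsorMap H x)) =
      torsorMap H ((θR.componentLinear k).rTensor H x) := by
  induction x using TensorProduct.induction_on with
  | zero => simp
  | add x y hx hy => simp only [map_add, hx, hy]
  | tmul r c =>
    rw [torsorMap_tmul, map_mul, tensorSelf_tmul_one, hH c c.2, MvPowerSeries.coeff_mul_C,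
      MvPowerSeries.coeff_map, LinearMap.rTensor_tmul, torsorMap_tmul]
    rfl

/-- The kernel is stable, since the map intertwines the iterative derivations, and it meets `H`
trivially, since `H` is a subalgebra of `R ⊗[F] R`. -/
theorem torsorMap_injective (hs : θR.toIterativeDerivation.IsSimple)
    (hc : {r : R | θR.IsConstant r} = algebraMap F R '' {a : F | θ.IsConstant a})
    {H : Subalgebra θ.constants (R ⊗[F] R)}
    (hH : ∀ c ∈ H, θR.tensorSelf c = MvPowerSeries.C c) : Function.Injective (torsorMap H) := by
  have h := θR.submodule_tensor_eq_bot hs hc (LinearMap.ker (torsorMap H).toLinearMap)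
    (fun x hx k => by
      have hx : torsorMap H x = 0 := hx
      change torsorMap H _ = 0
      rw [← θR.coeff_tensorSelf_torsorMap hH, hx, map_zero, map_zero])
    (fun c hc => by
      have hc : torsorMap H (1 ⊗ₜ c) = 0 := hc
      rw [torsorMap_tmul, ← one_def, one_mul] at hc
      exact_mod_cast hc)
  exact LinearMap.ker_eq_bot.1 h

theorem one_tmul_fundamental (Y : GL (Fin n) R) (i j : Fin n) :
    (1 : R) ⊗ₜ[F] Y.val i j = ∑ l, (Y.val i l ⊗ₜ[F] (1 : R)) * (torsorMatrix F Y).val l j := by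
  have h : Matrix.GeneralLinearGroup.map (includeRight : R →ₐ[F] R ⊗[F] R).toRingHom Y =
    Matrix.GeneralLinearGroup.map (includeLeftRingHom : R →+* R ⊗[F] R) Y * torsorMatrix F Y := by
    rw [torsorMatrix, mul_inv_cancel_left]
  have h' := congrArg (fun M : GL (Fin n) _ => M.val i j) h
  exact h'

theorem one_tmul_det_inv (Y : GL (Fin n) R) :
    (1 : R) ⊗ₜ[F] ((Matrix.GeneralLinearGroup.det Y)⁻¹ : Rˣ).val =
      (((Matrix.GeneralLinearGroup.det Y)⁻¹ : Rˣ).val ⊗ₜ[F] (1 : R)) *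
        ((Matrix.GeneralLinearGroup.det (torsorMatrix F Y))⁻¹ : (R ⊗[F] R)ˣ).val := by
  have h : Matrix.GeneralLinearGroup.map (includeRight : R →ₐ[F] R ⊗[F] R).toRingHom Y =
    Matrix.GeneralLinearGroup.map (includeLeftRingHom : R →+* R ⊗[F] R) Y * torsorMatrix F Y := by
    rw [torsorMatrix, mul_inv_cancel_left]
  have h' := congrArg (fun M => ((Matrix.GeneralLinearGroup.det M)⁻¹).val) h
  simp only [map_mul, mul_inv, Matrix.GeneralLinearGroup.map_det, ← map_inv] at h'
  exact h'

/-- The image contains `R ⊗ 1` and `Z`, hence `1 ⊗ Y = (Y ⊗ 1) Z` and its inverse determinant, hence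
`1 ⊗ R`. -/
theorem torsorMap_surjective {Y : GL (Fin n) R}
    (hgen : Algebra.adjoin F (Set.range (fun ij : Fin n × Fin n => Y.val ij.1 ij.2) ∪
      {((Matrix.GeneralLinearGroup.det Y)⁻¹ : Rˣ).val}) = ⊤) :
    Function.Surjective (torsorMap (torsorAlgebra θ Y)) := by
  let T : Subalgebra R (R ⊗[F] R) := (torsorMap (torsorAlgebra θ Y)).range
  have hl : ∀ r : R, r ⊗ₜ[F] (1 : R) ∈ T := fun r => T.algebraMap_mem r
  have hZ : ∀ c ∈ torsorAlgebra θ Y, c ∈ T := fun c hc =>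
    ⟨1 ⊗ₜ ⟨c, hc⟩, by change (1 : R ⊗[F] R) * c = c; rw [one_mul]⟩
  have hr : ∀ s : R, (1 : R) ⊗ₜ[F] s ∈ T := by
    have : (⊤ : Subalgebra F R) ≤ (T.restrictScalars F).comap includeRight := by
      rw [← hgen, Algebra.adjoin_le_iff]
      rintro _ (⟨ij, rfl⟩ | rfl)
      · change (1 : R) ⊗ₜ[F] Y.val ij.1 ij.2 ∈ T
        rw [one_tmul_fundamental]
        exact sum_mem fun l _ => mul_mem (hl _)
          (hZ _ (Algebra.subset_adjoin (Or.inl ⟨(l, ij.2), rfl⟩)))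
      · change (1 : R) ⊗ₜ[F] ((Matrix.GeneralLinearGroup.det Y)⁻¹ : Rˣ).val ∈ T
        rw [one_tmul_det_inv]
        exact mul_mem (hl _) (hZ _ (Algebra.subset_adjoin (Or.inr rfl)))
    exact fun s => this (x := s) trivial
  intro x
  change x ∈ T
  induction x using TensorProduct.induction_on with
  | zero => exact zero_mem _
  | add x y hx hy => exact add_mem hx hy
  | tmul r s => simpa using mul_mem (hl r) (hr s)

end IDExtension
end

/-! ### From points of the torsor algebra to endomorphisms of `R ⊗[K] L`. -/

noncomputable section

namespace IDExtension

open Algebra.TensorProduct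

variable {m : ℕ} {F : Type u} [Field F] {θ : IterativeDerivation m F}
  {R : Type u} [CommRing R] [Algebra F R] (θR : IDExtension θ R)

section Tensor

variable {L : Type u} [CommRing L] [Algebra θ.constants L]

theorem componentTensor_tmul (k : Fin m →₀ ℕ) (r : R) (l : L) :
    θR.componentTensor L k (r ⊗ₜ l) = θR.componentLinear k r ⊗ₜ l := rfl

theorem componentTensor_mul_one_tmul (k : Fin m →₀ ℕ) (x : R ⊗[θ.constants] L) (l : L) :
    θR.componentTensor L k (x * (1 ⊗ₜ l)) = θR.componentTensor L k x * (1 ⊗ₜ l) := by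
  induction x using TensorProduct.induction_on with
  | zero => simp
  | add x y hx hy => simp only [add_mul, map_add, hx, hy]
  | tmul r s => simp [componentTensor_tmul]

theorem componentTensor_tmul_one_mul (k : Fin m →₀ ℕ) (r : R) (x : R ⊗[θ.constants] L) :
    θR.componentTensor L k ((r ⊗ₜ 1) * x) = ∑ ij ∈ Finset.HasAntidiagonal.antidiagonal k,
      (θR.component ij.1 r ⊗ₜ 1) * θR.componentTensor L ij.2 x := by
  classical
  induction x using TensorProduct.induction_on with
  | zero => simp
  | add x y hx hy => simp only [mul_add, map_add, hx, hy, Finset.sum_add_distrib]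
  | tmul s l =>
    have h : θR.componentLinear k (r * s) = ∑ ij ∈ Finset.HasAntidiagonal.antidiagonal k,
        θR.component ij.1 r * θR.component ij.2 s := by
      change MvPowerSeries.coeff k (θR.toRingHom (r * s)) = _
      rw [map_mul, MvPowerSeries.coeff_mul]
      rfl
    simp only [componentTensor_tmul, tmul_mul_tmul, one_mul, h,
      TensorProduct.sum_tmul]
    rfl

theorem autID_ext {θR : IDExtension θ R} {φ ψ : θR.autID L}
    (h : ∀ r : R, φ.1 (r ⊗ₜ 1) = ψ.1 (r ⊗ₜ 1)) : φ = ψ := by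
  refine Subtype.ext (AlgEquiv.ext fun x => ?_)
  have h1 : ∀ (φ : θR.autID L) (l : L), φ.1 (1 ⊗ₜ l) = 1 ⊗ₜ l := fun φ l => by
    simpa using φ.2.1 1 l
  induction x using TensorProduct.induction_on with
  | zero => simp
  | add x y hx hy => simp only [map_add, hx, hy]
  | tmul r l =>
    have : r ⊗ₜ[θ.constants] l = (r ⊗ₜ 1) * (1 ⊗ₜ l) := by simp
    rw [this, map_mul, map_mul, h, h1, h1]

end Tensor

variable {H : Subalgebra θ.constants (R ⊗[F] R)} (hb : Function.Bijective (torsorMap H))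

/-- The isomorphism `R ⊗ H ≃ R ⊗ R`. -/
def torsorEquiv : R ⊗[θ.constants] H ≃ₐ[R] R ⊗[F] R := AlgEquiv.ofBijective (torsorMap H) hb

section Point

variable {L : Type u} [CommRing L] [Algebra θ.constants L] (g : H →ₐ[θ.constants] L)

/-- The `R`-algebra homomorphism `R ⊗ R → R ⊗ L` attached to a point `g : H → L`. -/
def pointMap : R ⊗[F] R →ₐ[R] R ⊗[θ.constants] L :=
  (Algebra.TensorProduct.map (AlgHom.id R R) g).comp (torsorEquiv hb).symm.toAlgHom

theorem pointMap_torsorMap (x : R ⊗[θ.constants] H) : pointMap hb g (torsorMap H x) =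
    Algebra.TensorProduct.map (AlgHom.id R R) g x :=
  congrArg _ ((torsorEquiv hb).symm_apply_apply x)

theorem pointMap_coe (c : H) : pointMap hb g (c : R ⊗[F] R) = 1 ⊗ₜ g c := by
  have h := pointMap_torsorMap hb g (1 ⊗ₜ c)
  rwa [torsorMap_tmul, ← one_def, one_mul, map_tmul, AlgHom.id_apply] at h

theorem pointMap_tmul_one (r : R) : pointMap hb g (r ⊗ₜ 1) = r ⊗ₜ 1 :=
  (pointMap hb g).commutes r

theorem pointMap_eq {ψ : R ⊗[F] R →ₐ[R] R ⊗[θ.constants] L}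
    (h : ∀ c : H, ψ (c : R ⊗[F] R) = 1 ⊗ₜ g c) : pointMap hb g = ψ := by
  refine AlgHom.ext fun x => ?_
  obtain ⟨x, rfl⟩ := hb.2 x
  rw [pointMap_torsorMap]
  induction x using TensorProduct.induction_on with
  | zero => simp
  | add x y hx hy => simp only [map_add, hx, hy]
  | tmul r c =>
    have h1 : ψ (r ⊗ₜ 1) = r ⊗ₜ 1 := ψ.commutes r
    rw [torsorMap_tmul, map_mul, h, h1]
    simp

theorem pointMap_coeff (hH : ∀ c ∈ H, θR.tensorSelf c = MvPowerSeries.C c) (k : Fin m →₀ ℕ)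
    (x : R ⊗[F] R) : pointMap hb g (MvPowerSeries.coeff k (θR.tensorSelf x)) =
      θR.componentTensor L k (pointMap hb g x) := by
  obtain ⟨x, rfl⟩ := hb.2 x
  rw [coeff_tensorSelf_torsorMap θR hH, pointMap_torsorMap, pointMap_torsorMap]
  induction x using TensorProduct.induction_on with
  | zero => simp
  | add x y hx hy => simp only [map_add, hx, hy]
  | tmul r c => simp [componentTensor_tmul]

/-- The endomorphism of `R ⊗ L` attached to a point `g : H → L`. -/
def pointEnd : R ⊗[θ.constants] L →ₐ[F] R ⊗[θ.constants] L :=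
  Algebra.TensorProduct.lift (((pointMap hb g).restrictScalars F).comp includeRight) includeRight
    fun _ _ => .all _ _

theorem pointEnd_tmul (r : R) (l : L) :
    pointEnd hb g (r ⊗ₜ l) = pointMap hb g (1 ⊗ₜ r) * (1 ⊗ₜ l) := rfl

theorem pointEnd_tmul_one (r : R) : pointEnd hb g (r ⊗ₜ 1) = pointMap hb g (1 ⊗ₜ r) := by
  rw [pointEnd_tmul, ← one_def, mul_one]

theorem pointEnd_one_tmul (l : L) : pointEnd hb g (1 ⊗ₜ l) = 1 ⊗ₜ l := by
  rw [pointEnd_tmul, ← one_def, map_one, one_mul]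

theorem pointEnd_algebraMap_tmul (a : F) (l : L) :
    pointEnd hb g (algebraMap F R a ⊗ₜ l) = algebraMap F R a ⊗ₜ l := by
  have h : algebraMap F R a ⊗ₜ[θ.constants] l =
      algebraMap F (R ⊗[θ.constants] L) a * (1 ⊗ₜ l) := by
    rw [Algebra.TensorProduct.algebraMap_apply, tmul_mul_tmul, mul_one, one_mul]
  rw [h, map_mul, AlgHom.commutes, pointEnd_one_tmul]

theorem pointEnd_componentTensor (hH : ∀ c ∈ H, θR.tensorSelf c = MvPowerSeries.C c)
    (k : Fin m →₀ ℕ) (x : R ⊗[θ.constants] L) :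
    pointEnd hb g (θR.componentTensor L k x) = θR.componentTensor L k (pointEnd hb g x) := by
  induction x using TensorProduct.induction_on with
  | zero => simp
  | add x y hx hy => simp only [map_add, hx, hy]
  | tmul r l =>
    rw [pointEnd_tmul, componentTensor_mul_one_tmul, ← pointMap_coeff θR hb g hH,
      tensorSelf_one_tmul, MvPowerSeries.coeff_map]
    rfl

/-- The kernel is a stable submodule of `R ⊗ L`, and it meets `L` trivially because `L` is fixed. -/
theorem pointEnd_injective (hs : θR.toIterativeDerivation.IsSimple)
    (hc : {r : R | θR.IsConstant r} = algebraMap F R '' {a : F | θ.IsConstant a})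
    (hH : ∀ c ∈ H, θR.tensorSelf c = MvPowerSeries.C c) :
    Function.Injective (pointEnd hb g) := by
  have := hs.1
  have h := θR.submodule_tensor_eq_bot hs hc
    ((RingHom.ker (pointEnd hb g)).restrictScalars R)
    (fun x hx k => by
      have hx : pointEnd hb g x = 0 := hx
      change pointEnd hb g (θR.componentTensor L k x) = 0
      rw [pointEnd_componentTensor θR hb g hH, hx, map_zero])
    (fun l hl => by
      have hl : pointEnd hb g (1 ⊗ₜ l) = 0 := hl
      rw [pointEnd_one_tmul] at hl
      exact (Algebra.TensorProduct.includeRight_injective (R := θ.constants) (A := R) (B := L)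
        (algebraMap θ.constants R).injective) (hl.trans (map_zero _).symm))
  rw [injective_iff_map_eq_zero]
  intro x hx
  have : x ∈ (RingHom.ker (pointEnd hb g)).restrictScalars R := hx
  rwa [h] at this

end Point

section Generated

variable {n : ℕ} {Y : GL (Fin n) R}

/-- Adjoining the inverse determinant makes `Z` invertible over the torsor algebra itself, so a
point sends it to an invertible matrix over `L`. -/
theorem exists_torsorMatrix_lift (Y : GL (Fin n) R) : ∃ N : GL (Fin n) (torsorAlgebra θ Y),
    Matrix.GeneralLinearGroup.map (torsorAlgebra θ Y).val.toRingHom N = torsorMatrix F Y := by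
  let N : Matrix (Fin n) (Fin n) (torsorAlgebra θ Y) := fun i j =>
    ⟨(torsorMatrix F Y).val i j, Algebra.subset_adjoin (Or.inl ⟨(i, j), rfl⟩)⟩
  let d : torsorAlgebra θ Y := ⟨((Matrix.GeneralLinearGroup.det (torsorMatrix F Y))⁻¹).val,
    Algebra.subset_adjoin (Or.inr rfl)⟩
  have hd : N.det * d = 1 := by
    refine Subtype.ext ?_
    have h1 : ((N.det : torsorAlgebra θ Y) : R ⊗[F] R) = (torsorMatrix F Y).val.det :=
      (torsorAlgebra θ Y).val.toRingHom.map_det N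
    rw [MulMemClass.coe_mul, h1]
    exact (Matrix.GeneralLinearGroup.det (torsorMatrix F Y)).mul_inv
  exact ⟨Matrix.GeneralLinearGroup.mk'' N (.of_mul_eq_one _ hd), by ext i j; rfl⟩

/-- The endomorphism sends `Y` to `Y M` with `M` invertible over `L`. As `L` is fixed, multiplying
by `M⁻¹` puts `Y` back into the image. -/
theorem pointEnd_surjective (hb : Function.Bijective (torsorMap (torsorAlgebra θ Y)))
    (hgen : Algebra.adjoin F (Set.range (fun ij : Fin n × Fin n => Y.val ij.1 ij.2) ∪
      {((Matrix.GeneralLinearGroup.det Y)⁻¹ : Rˣ).val}) = ⊤)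
    {L : Type u} [CommRing L] [Algebra θ.constants L]
    (g : torsorAlgebra θ Y →ₐ[θ.constants] L) : Function.Surjective (pointEnd hb g) := by
  obtain ⟨N, hN⟩ := exists_torsorMatrix_lift (θ := θ) Y
  let T : Subalgebra F (R ⊗[θ.constants] L) := (pointEnd hb g).range
  have hr : ∀ l : L, (1 : R) ⊗ₜ[θ.constants] l ∈ T := fun l => ⟨1 ⊗ₜ l, pointEnd_one_tmul hb g l⟩
  let M : GL (Fin n) (R ⊗[θ.constants] L) := Matrix.GeneralLinearGroup.map
    ((includeRight : L →ₐ[θ.constants] R ⊗[θ.constants] L).comp g).toRingHom N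
  let Y1 : GL (Fin n) (R ⊗[θ.constants] L) := Matrix.GeneralLinearGroup.map
    (includeLeftRingHom : R →+* R ⊗[θ.constants] L) Y
  have hY : Matrix.GeneralLinearGroup.map (pointEnd hb g).toRingHom Y1 = Y1 * M := by
    have h : Matrix.GeneralLinearGroup.map (includeRight : R →ₐ[F] R ⊗[F] R).toRingHom Y =
      Matrix.GeneralLinearGroup.map (includeLeftRingHom : R →+* R ⊗[F] R) Y *
        torsorMatrix F Y := by
      rw [torsorMatrix, mul_inv_cancel_left]
    have h1 := congrArg (Matrix.GeneralLinearGroup.map (pointMap hb g).toRingHom) h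
    rw [map_mul, ← hN] at h1
    convert h1 using 1
    · ext i j : 2
      exact pointEnd_tmul_one hb g _
    · congr 1
      · ext i j : 2
        exact (pointMap_tmul_one hb g _).symm
      · ext i j : 2
        exact (pointMap_coe hb g _).symm
  have hY' : Y1 = Matrix.GeneralLinearGroup.map (pointEnd hb g).toRingHom Y1 * M⁻¹ := by
    rw [hY, mul_inv_cancel_right]
  have hl : ∀ r : R, r ⊗ₜ[θ.constants] (1 : L) ∈ T := by
    have : (⊤ : Subalgebra F R) ≤ T.comap includeLeft := by
      rw [← hgen, Algebra.adjoin_le_iff]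
      rintro _ (⟨ij, rfl⟩ | rfl)
      · change Y1.val ij.1 ij.2 ∈ T
        rw [hY', Units.val_mul, Matrix.mul_apply]
        refine sum_mem fun l _ => mul_mem ⟨Y1.val ij.1 l, rfl⟩ ?_
        rw [← map_inv]
        exact hr _
      · have hdet : ((Matrix.GeneralLinearGroup.det Y)⁻¹).val ⊗ₜ[θ.constants] (1 : L) =
            ((Matrix.GeneralLinearGroup.det Y1)⁻¹).val := by
          rw [Matrix.GeneralLinearGroup.map_det, ← map_inv]
          rfl
        change ((Matrix.GeneralLinearGroup.det Y)⁻¹).val ⊗ₜ[θ.constants] (1 : L) ∈ T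
        have hd : (Matrix.GeneralLinearGroup.det Y1)⁻¹ = (Matrix.GeneralLinearGroup.det
            (Matrix.GeneralLinearGroup.map (pointEnd hb g).toRingHom Y1))⁻¹ *
              Matrix.GeneralLinearGroup.det M := by
          rw [hY, map_mul, mul_inv_rev, mul_comm (Matrix.GeneralLinearGroup.det M)⁻¹,
            inv_mul_cancel_right]
        rw [hdet, hd, Units.val_mul]
        refine mul_mem ?_ ?_
        · rw [Matrix.GeneralLinearGroup.map_det, ← map_inv]
          exact ⟨_, rfl⟩
        · rw [Matrix.GeneralLinearGroup.map_det]
          exact hr _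
    exact fun r => this (x := r) trivial
  intro x
  change x ∈ T
  induction x using TensorProduct.induction_on with
  | zero => exact zero_mem _
  | add x y hx hy => exact add_mem hx hy
  | tmul r s => simpa using mul_mem (hl r) (hr s)

end Generated

end IDExtension
end

/-! ### Points are exactly the ID-automorphisms; the Galois group scheme. -/

noncomputable section

namespace IDExtension

open Algebra.TensorProduct

variable {m : ℕ} {F : Type u} [Field F] {θ : IterativeDerivation m F}
  {R : Type u} [CommRing R] [Algebra F R] {θR : IDExtension θ R} {n : ℕ} {A : IDE θ n}
  {Y : GL (Fin n) R}

/-- `Y` is a fundamental solution matrix whose entries and inverse determinant generate `R`. -/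
structure IsGeneratedBy (θR : IDExtension θ R) (A : IDE θ n) (Y : GL (Fin n) R) : Prop where
  fundamental : θR.IsFundamental A Y
  adjoin_eq_top : Algebra.adjoin F (Set.range (fun ij : Fin n × Fin n => Y.val ij.1 ij.2) ∪
      {((Matrix.GeneralLinearGroup.det Y)⁻¹ : Rˣ).val}) = ⊤

theorem IsPPVRing.torsorMap_bijective (hR : θR.IsPPVRing A) (hY : θR.IsGeneratedBy A Y) :
    Function.Bijective (torsorMap (torsorAlgebra θ Y)) :=
  ⟨torsorMap_injective θR hR.simple hR.constants_eq
    fun _ hc => tensorSelf_of_mem_torsorAlgebra hY.fundamental hc,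
    torsorMap_surjective hY.adjoin_eq_top⟩

variable (hR : θR.IsPPVRing A) (hY : θR.IsGeneratedBy A Y)

section

variable {L : Type u} [CommRing L] [Algebra θ.constants L]

/-- The automorphism of `R ⊗ L` attached to a point of the torsor algebra. -/
def pointAut (g : torsorAlgebra θ Y →ₐ[θ.constants] L) : θR.autID L :=
  ⟨AlgEquiv.ofBijective
    ((pointEnd (hR.torsorMap_bijective hY) g).restrictScalars θ.constants)
    ⟨pointEnd_injective θR _ g hR.simple hR.constants_eq
      fun _ hc => tensorSelf_of_mem_torsorAlgebra hY.fundamental hc,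
      pointEnd_surjective _ hY.adjoin_eq_top g⟩,
    fun a l => pointEnd_algebraMap_tmul _ g a l,
    fun k x => pointEnd_componentTensor θR _ g
      (fun _ hc => tensorSelf_of_mem_torsorAlgebra hY.fundamental hc) k x⟩

theorem pointAut_tmul_one (g : torsorAlgebra θ Y →ₐ[θ.constants] L) (r : R) :
    (pointAut hR hY g).1 (r ⊗ₜ 1) = pointMap (hR.torsorMap_bijective hY) g (1 ⊗ₜ r) :=
  pointEnd_tmul_one _ g r

/-- The `R`-algebra homomorphism `R ⊗ R → R ⊗ L`, `r ⊗ s ↦ r φ(s)`. -/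
def autIDMap (φ : θR.autID L) : R ⊗[F] R →ₐ[R] R ⊗[θ.constants] L :=
  Algebra.TensorProduct.lift (Algebra.ofId R _)
    { (φ.1 : R ⊗[θ.constants] L →ₐ[θ.constants] R ⊗[θ.constants] L).toRingHom.comp
        includeLeftRingHom with
      commutes' := fun a => φ.2.1 a 1 } fun _ _ => .all _ _

theorem autIDMap_tmul (φ : θR.autID L) (r s : R) :
    autIDMap φ (r ⊗ₜ s) = (r ⊗ₜ 1) * φ.1 (s ⊗ₜ 1) := rfl

theorem autIDMap_coeff (φ : θR.autID L) (k : Fin m →₀ ℕ) (x : R ⊗[F] R) :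
    autIDMap φ (MvPowerSeries.coeff k (θR.tensorSelf x)) =
      θR.componentTensor L k (autIDMap φ x) := by
  classical
  induction x using TensorProduct.induction_on with
  | zero => simp
  | add x y hx hy => simp only [map_add, hx, hy]
  | tmul r s =>
    rw [tensorSelf_tmul, MvPowerSeries.coeff_mul, autIDMap_tmul, componentTensor_tmul_one_mul,
      map_sum]
    refine Finset.sum_congr rfl fun ij _ => ?_
    rw [← φ.2.2, MvPowerSeries.coeff_map, MvPowerSeries.coeff_map]
    change autIDMap φ ((θR.component ij.1 r ⊗ₜ 1) * (1 ⊗ₜ θR.component ij.2 s)) = _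
    rw [tmul_mul_tmul, one_mul, mul_one, autIDMap_tmul]
    rfl

/-- The map `r ⊗ s ↦ r φ(s)` commutes with the iterative derivations, so it sends constants to
constants, and those of `R ⊗ L` are `1 ⊗ L`. -/
theorem exists_pointMap_eq (hR : θR.IsPPVRing A) (φ : θR.autID L) {H : Subalgebra θ.constants (R ⊗[F] R)}
    (hH : ∀ c ∈ H, θR.tensorSelf c = MvPowerSeries.C c) :
    ∃ g : H →ₐ[θ.constants] L, ∀ c : H, autIDMap φ (c : R ⊗[F] R) = 1 ⊗ₜ g c := by
  classical
  have := hR.simple.1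
  have hinj := Algebra.TensorProduct.includeRight_injective (R := θ.constants) (A := R) (B := L)
    (algebraMap θ.constants R).injective
  let ι : L →ₐ[θ.constants] R ⊗[θ.constants] L := includeRight
  have h1 : ∀ c : H, autIDMap φ (c : R ⊗[F] R) ∈ ι.range := fun c => by
    obtain ⟨l, hl⟩ := θR.exists_one_tmul hR.constants_eq (autIDMap φ (c : R ⊗[F] R))
      fun k hk => by
        change θR.componentTensor L k _ = 0
        rw [← autIDMap_coeff, hH c c.2, MvPowerSeries.coeff_C, if_neg hk, map_zero]
    exact ⟨l, hl.symm⟩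
  let ψ : H →ₐ[θ.constants] R ⊗[θ.constants] L :=
    ((autIDMap φ).restrictScalars θ.constants).comp H.val
  refine ⟨(AlgEquiv.ofInjective ι hinj).symm.toAlgHom.comp (ψ.codRestrict ι.range h1),
    fun c => ?_⟩
  exact (congrArg Subtype.val
    ((AlgEquiv.ofInjective ι hinj).apply_symm_apply (ψ.codRestrict ι.range h1 c))).symm

theorem pointAut_bijective : Function.Bijective
    (pointAut hR hY : (torsorAlgebra θ Y →ₐ[θ.constants] L) → θR.autID L) := by
  have := hR.simple.1
  constructor
  · intro g g' h
    have h1 : pointMap (hR.torsorMap_bijective hY) g =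
        pointMap (hR.torsorMap_bijective hY) g' := by
      refine Algebra.TensorProduct.ext (by ext) ?_
      ext r
      have h2 := congrArg (fun φ : θR.autID L => φ.1 (r ⊗ₜ 1)) h
      simp only [pointAut_tmul_one] at h2
      exact h2
    ext c
    have h2 := DFunLike.congr_fun h1 (c : R ⊗[F] R)
    rw [pointMap_coe, pointMap_coe] at h2
    exact Algebra.TensorProduct.includeRight_injective (R := θ.constants) (A := R) (B := L)
      (algebraMap θ.constants R).injective h2
  · intro φ
    obtain ⟨g, hg⟩ := exists_pointMap_eq hR φ
      fun c hc => tensorSelf_of_mem_torsorAlgebra hY.fundamental hc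
    refine ⟨g, autID_ext fun r => ?_⟩
    rw [pointAut_tmul_one, pointMap_eq _ g hg, autIDMap_tmul, ← one_def, one_mul]

variable (L) in
/-- The bijection between points of the torsor algebra and automorphisms. -/
def pointsEquiv : (torsorAlgebra θ Y →ₐ[θ.constants] L) ≃ θR.autID L :=
  Equiv.ofBijective _ (pointAut_bijective hR hY)

variable {L' : Type u} [CommRing L'] [Algebra θ.constants L']

theorem pointsEquiv_natural (f : L →ₐ[θ.constants] L') (g : torsorAlgebra θ Y →ₐ[θ.constants] L)
    (x : R ⊗[θ.constants] L) :
    Algebra.TensorProduct.map (AlgHom.id θ.constants R) f ((pointsEquiv hR hY L g).1 x) =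
      (pointsEquiv hR hY L' (f.comp g)).1
        (Algebra.TensorProduct.map (AlgHom.id θ.constants R) f x) := by
  have h : pointMap (hR.torsorMap_bijective hY) (f.comp g) =
      (Algebra.TensorProduct.map (AlgHom.id R R) f).comp
        (pointMap (hR.torsorMap_bijective hY) g) := by
    refine pointMap_eq _ _ fun c => ?_
    rw [AlgHom.comp_apply, pointMap_coe]
    simp
  induction x using TensorProduct.induction_on with
  | zero => simp
  | add x y hx hy => simp only [map_add, hx, hy]
  | tmul r l =>
    change Algebra.TensorProduct.map (AlgHom.id θ.constants R) f (pointEnd _ g (r ⊗ₜ l)) =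
      pointEnd _ (f.comp g) (r ⊗ₜ f l)
    rw [pointEnd_tmul, pointEnd_tmul, map_mul, h]
    congr 1

end

/-- An automorphism is determined on the elements `r ⊗ 1`, and over `L'` these already come from `R
⊗ L`. -/
theorem pointsEquiv_isNatural :
    RepresentedGroup.IsNatural (fun L _ _ => pointsEquiv (A := A) hR hY L) := by
  intro L L' _ _ _ _ f x y
  refine (pointsEquiv hR hY L').injective (autID_ext fun r => ?_)
  simp only [RepresentedGroup.mul, Equiv.apply_symm_apply]
  have h1 : r ⊗ₜ[θ.constants] (1 : L') =
      Algebra.TensorProduct.map (AlgHom.id θ.constants R) f (r ⊗ₜ 1) := by simp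
  rw [h1, ← pointsEquiv_natural, Equiv.apply_symm_apply]
  change _ = (pointsEquiv hR hY L' (f.comp x)).1 ((pointsEquiv hR hY L' (f.comp y)).1 _)
  rw [← pointsEquiv_natural, ← pointsEquiv_natural]
  rfl

/-- The Hopf algebra structure of the torsor algebra. -/
abbrev torsorHopfAlgebra : HopfAlgebra θ.constants (torsorAlgebra θ Y) :=
  RepresentedGroup.hopfAlgebra _ (pointsEquiv_isNatural hR hY)

/-- The torsor algebra represents the functor of automorphisms. -/
def torsorGaloisGroupScheme :
    letI := torsorHopfAlgebra hR hY
    θR.GaloisGroupScheme (torsorAlgebra θ Y) :=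
  letI := torsorHopfAlgebra hR hY
  { equiv := fun L _ _ =>
      { (WithConv.equiv _).trans (pointsEquiv hR hY L) with
        map_mul' := fun x y => by
          have h := RepresentedGroup.convMul_eq _ (pointsEquiv_isNatural hR hY)
            (WithConv.ofConv x) (WithConv.ofConv y)
          change pointsEquiv hR hY L (WithConv.ofConv (x * y)) = _
          rw [show x * y = _ from h]
          exact (pointsEquiv hR hY L).apply_symm_apply _ }
    natural := fun L L' _ _ _ _ f g x => pointsEquiv_natural hR hY f g x }

end IDExtension
end

/-! ### Uniqueness of the representing Hopf algebra, and the Frobenius criterion. -/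

noncomputable section

namespace IDExtension

open Algebra.TensorProduct

variable {m : ℕ} {F : Type u} [Field F] {θ : IterativeDerivation m F}
  {R : Type u} [CommRing R] [Algebra F R] {θR : IDExtension θ R} {n : ℕ} {A : IDE θ n}
  {Y : GL (Fin n) R}

section Comparison

variable {H : Type u} [CommRing H] [HopfAlgebra θ.constants H]

theorem GaloisGroupScheme.equiv_comp (hR : θR.IsPPVRing A) (hY : θR.IsGeneratedBy A Y)
    (𝒢 : θR.GaloisGroupScheme H) {L L' : Type u} [CommRing L] [Algebra θ.constants L]
    [CommRing L'] [Algebra θ.constants L'] (f : L →ₐ[θ.constants] L') {g : H →ₐ[θ.constants] L}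
    {g' : torsorAlgebra θ Y →ₐ[θ.constants] L}
    (h : 𝒢.equiv L (WithConv.toConv g) = pointsEquiv hR hY L g') :
    𝒢.equiv L' (WithConv.toConv (f.comp g)) = pointsEquiv hR hY L' (f.comp g') := by
  refine autID_ext fun r => ?_
  have h1 : r ⊗ₜ[θ.constants] (1 : L') =
      Algebra.TensorProduct.map (AlgHom.id θ.constants R) f (r ⊗ₜ 1) := by simp
  rw [h1, ← pointsEquiv_natural, ← 𝒢.natural, h]

/-- Every representing Hopf algebra is isomorphic to the torsor algebra, its counit corresponding
to the multiplication of `R`. -/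
theorem GaloisGroupScheme.exists_algEquiv (hR : θR.IsPPVRing A) (hY : θR.IsGeneratedBy A Y)
    (𝒢 : θR.GaloisGroupScheme H) : ∃ α : H ≃ₐ[θ.constants] torsorAlgebra θ Y,
      ∀ x : H, algebraMap θ.constants R (Bialgebra.counitAlgHom θ.constants H x) =
        lmul' F (α x : R ⊗[F] R) := by
  let T := torsorAlgebra θ Y
  -- Yoneda: `α` and `β` are the points matching the universal automorphism of the other side.
  let α : H →ₐ[θ.constants] T :=
    WithConv.ofConv ((𝒢.equiv T).symm (pointsEquiv hR hY T (AlgHom.id _ _)))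
  let β : T →ₐ[θ.constants] H :=
    (pointsEquiv hR hY H).symm (𝒢.equiv H (WithConv.toConv (AlgHom.id _ _)))
  have hα : 𝒢.equiv T (WithConv.toConv α) = pointsEquiv hR hY T (AlgHom.id _ _) :=
    (𝒢.equiv T).apply_symm_apply _
  have hβ : 𝒢.equiv H (WithConv.toConv (AlgHom.id _ _)) = pointsEquiv hR hY H β :=
    ((pointsEquiv hR hY H).apply_symm_apply _).symm
  have hβα : β.comp α = AlgHom.id _ _ := by
    have h := 𝒢.equiv_comp hR hY β hα
    rw [AlgHom.comp_id, ← hβ] at h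
    exact WithConv.toConv_injective ((𝒢.equiv H).injective h)
  have hαβ : α.comp β = AlgHom.id _ _ := by
    have h := 𝒢.equiv_comp hR hY α hβ
    rw [AlgHom.comp_id, hα] at h
    exact ((pointsEquiv hR hY T).injective h).symm
  refine ⟨AlgEquiv.ofAlgHom α β hαβ hβα, fun x => ?_⟩
  set ε := Bialgebra.counitAlgHom θ.constants H
  -- The counit is neutral for convolution, so it corresponds to the identity automorphism, whose
  -- map `r ⊗ s ↦ r φ(s)` is multiplication.
  have hε : pointsEquiv hR hY θ.constants (ε.comp β) = 1 := by
    rw [← 𝒢.equiv_comp hR hY ε hβ, ← map_one (𝒢.equiv θ.constants)]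
    rfl
  have hψ : pointMap (hR.torsorMap_bijective hY) (ε.comp β) =
      (includeLeft : R →ₐ[R] R ⊗[θ.constants] θ.constants).comp (lmul'' F (S := R)) := by
    refine Algebra.TensorProduct.ext (by ext) ?_
    ext r
    have h := congrArg (fun φ : θR.autID θ.constants => φ.1 (r ⊗ₜ 1)) hε
    have h2 := (pointAut_tmul_one hR hY (ε.comp β) r).symm.trans h
    exact h2.trans (congrArg (· ⊗ₜ 1) (one_mul r).symm)
  have h1 := DFunLike.congr_fun hψ (α x : R ⊗[F] R)
  rw [pointMap_coe, AlgHom.comp_apply, ← AlgHom.comp_apply β, hβα] at h1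
  have h2 := congrArg (Algebra.TensorProduct.rid θ.constants θ.constants R) h1
  simp only [rid_tmul, Algebra.smul_def, mul_one] at h2
  exact h2.trans (by simp; rfl)

end Comparison

section Frobenius

variable {p : ℕ} [Fact p.Prime] [CharP F p]

/-- Applying `id ⊗ f` for a functional with `f 1 ≠ 0` gives `f(1) a = f(a) 1`. -/
theorem mem_range_of_tmul_comm {a : R} (h : a ⊗ₜ[F] (1 : R) = 1 ⊗ₜ a) [Nontrivial R] :
    a ∈ (algebraMap F R).range := by
  obtain ⟨f, hf⟩ := Module.Projective.exists_dual_ne_zero F (one_ne_zero : (1 : R) ≠ 0)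
  have h1 := congrArg (TensorProduct.rid F R ∘ f.lTensor R) h
  simp only [Function.comp_apply, LinearMap.lTensor_tmul, TensorProduct.rid_tmul] at h1
  refine ⟨(f 1)⁻¹ * f a, ?_⟩
  rw [map_mul, ← mul_one (algebraMap F R (f a)), ← Algebra.smul_def (f a), ← h1,
    ← Algebra.smul_def, smul_smul, inv_mul_cancel₀ hf, one_smul]

/-- By `hα` the augmentation ideal is the part of the torsor algebra killed by `μ`. Both directions
pass through `hS`, and Frobenius additivity lets `hS` be checked on generating tensors. -/
theorem pow_eq_zero_iff_pow_mem_range (hR : θR.IsPPVRing A) (hY : θR.IsGeneratedBy A Y)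
    {H : Type u} [CommRing H] [HopfAlgebra θ.constants H] (α : H ≃ₐ[θ.constants] torsorAlgebra θ Y)
    (hα : ∀ x : H, algebraMap θ.constants R (Bialgebra.counitAlgHom θ.constants H x) =
        lmul' F (α x : R ⊗[F] R)) (e : ℕ) :
    (∀ x ∈ augmentationIdeal θ.constants H, x ^ p ^ e = 0) ↔
      ∀ r : R, r ^ p ^ e ∈ (algebraMap F R).range := by
  have := hR.simple.1
  have : Nontrivial (R ⊗[F] R) := (lmul' F (S := R)).toRingHom.domain_nontrivial
  have : CharP (R ⊗[F] R) p :=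
    charP_of_injective_algebraMap (algebraMap F (R ⊗[F] R)).injective p
  have hmem : ∀ x : H, x ∈ augmentationIdeal θ.constants H ↔ lmul' F (α x : R ⊗[F] R) = 0 :=
    fun x => by
      rw [← hα, augmentationIdeal, RingHom.mem_ker]
      exact ((algebraMap θ.constants R).injective.eq_iff' (map_zero _)).symm
  constructor
  · intro h r
    have hT : ∀ c : torsorAlgebra θ Y,
        (c : R ⊗[F] R) ^ p ^ e = (lmul' F (c : R ⊗[F] R) ⊗ₜ 1) ^ p ^ e := fun c => by
      obtain ⟨x, rfl⟩ := α.surjective c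
      set ε := Bialgebra.counitAlgHom θ.constants H
      -- Subtracting the counit moves any element into the augmentation ideal; its vanishing power
      -- then reads `c^q = μ(c)^q ⊗ 1`.
      have h1 : x - algebraMap θ.constants H (ε x) ∈ augmentationIdeal θ.constants H := by
        change ε _ = 0
        rw [map_sub, AlgHom.commutes]
        exact sub_self _
      have h2 := congrArg (fun y => ((α y : torsorAlgebra θ Y) : R ⊗[F] R)) (h _ h1)
      simp only [map_pow, map_sub, AlgEquiv.commutes, map_zero, ZeroMemClass.coe_zero,
        SubmonoidClass.coe_pow, AddSubgroupClass.coe_sub] at h2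
      rw [sub_pow_char_pow, sub_eq_zero] at h2
      rw [h2, ← hα]
      rfl
    have hS : ∀ x : R ⊗[F] R, x ^ p ^ e = (lmul' F x ⊗ₜ 1) ^ p ^ e := by
      intro x
      obtain ⟨x, rfl⟩ := (hR.torsorMap_bijective hY).2 x
      induction x using TensorProduct.induction_on with
      | zero => simp
      | add x y hx hy =>
        rw [map_add, map_add, TensorProduct.add_tmul, add_pow_char_pow, add_pow_char_pow, hx, hy]
      | tmul s c =>
        rw [torsorMap_tmul, mul_pow, hT, ← mul_pow, tmul_mul_tmul, map_mul]
        simp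
    -- For `z = 1 ⊗ r` this becomes `1 ⊗ r^q = r^q ⊗ 1`, which forces `r^q` into `F`.
    have h1 := hS (1 ⊗ₜ r)
    rw [lmul'_apply_tmul, one_mul, tmul_pow, tmul_pow, one_pow] at h1
    exact mem_range_of_tmul_comm h1.symm
  · intro h x hx
    have hS : ∀ x : R ⊗[F] R, x ^ p ^ e = (lmul' F x ⊗ₜ 1) ^ p ^ e := by
      intro x
      induction x using TensorProduct.induction_on with
      | zero => simp
      | add x y hx hy =>
        rw [map_add, TensorProduct.add_tmul, add_pow_char_pow, add_pow_char_pow, hx, hy]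
      | tmul r s =>
        obtain ⟨a, ha⟩ := h s
        rw [lmul'_apply_tmul, tmul_pow, tmul_pow, one_pow, mul_pow, ← ha, mul_comm,
          ← Algebra.smul_def, Algebra.algebraMap_eq_smul_one, TensorProduct.tmul_smul,
          TensorProduct.smul_tmul']
    refine α.injective (Subtype.ext ?_)
    rw [map_pow, map_zero, SubmonoidClass.coe_pow, hS, (hmem x).1 hx]
    simp [(Fact.out : p.Prime).ne_zero]

end Frobenius

end IDExtension

/-! ### Passage to the fraction field, uniform exponents, and the theorem. -/

section

variable {F R E : Type*} [Field F] [CommRing R] [Algebra F R] [Field E] [Algebra R E]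
  [IsFractionRing R E] [Algebra F E] [IsScalarTower F R E]

theorem IsFractionRing.forall_pow_mem_range_iff (q : ℕ) :
    (∀ r : R, r ^ q ∈ (algebraMap F R).range) ↔ ∀ x : E, x ^ q ∈ (algebraMap F E).range := by
  constructor
  · intro h x
    obtain ⟨a, b, _, rfl⟩ := IsFractionRing.div_surjective (A := R) x
    obtain ⟨a', ha⟩ := h a
    obtain ⟨b', hb⟩ := h b
    refine ⟨a' / b', ?_⟩
    rw [div_pow, ← map_pow, ← map_pow, ← ha, ← hb, map_div₀,
      ← IsScalarTower.algebraMap_apply, ← IsScalarTower.algebraMap_apply]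
  · intro h r
    obtain ⟨a, ha⟩ := h (algebraMap R E r)
    refine ⟨a, IsFractionRing.injective R E ?_⟩
    rw [← IsScalarTower.algebraMap_apply, ha, map_pow]

/-- The largest exponent among finitely many generators of `R` serves all of `R`, because `p ^ e`-th
powers respect sums and products. -/
theorem IsPurelyInseparable.exists_forall_pow_mem_range (p : ℕ) [ExpChar F p]
    [Algebra.FiniteType F R] [IsPurelyInseparable F E] :
    ∃ e : ℕ, ∀ x : E, x ^ p ^ e ∈ (algebraMap F E).range := by
  obtain ⟨s, hs⟩ := (inferInstance : Algebra.FiniteType F R).out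
  have : Nontrivial R := (algebraMap R E).domain_nontrivial
  have : ExpChar R p := expChar_of_injective_algebraMap (algebraMap F R).injective p
  have h1 : ∀ r : R, ∃ e : ℕ, r ^ p ^ e ∈ (algebraMap F R).range := fun r => by
    obtain ⟨e, a, ha⟩ := (isPurelyInseparable_iff_pow_mem F p).1 ‹_› (algebraMap R E r)
    refine ⟨e, a, IsFractionRing.injective R E ?_⟩
    rw [← IsScalarTower.algebraMap_apply, ha, map_pow]
  choose e he using h1
  refine ⟨s.sup e, (IsFractionRing.forall_pow_mem_range_iff (R := R) _).1 fun r => ?_⟩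
  have hr : r ∈ Algebra.adjoin F (s : Set R) := hs ▸ trivial
  induction hr using Algebra.adjoin_induction with
  | mem x hx =>
    obtain ⟨k, hk⟩ := Nat.exists_eq_add_of_le (Finset.le_sup (f := e) hx)
    rw [hk, pow_add, pow_mul]
    exact _root_.pow_mem (he x) _
  | algebraMap a => exact _root_.pow_mem (RingHom.mem_range_self _ a) _
  | add x y _ _ hx hy => rw [add_pow_expChar_pow]; exact add_mem hx hy
  | mul x y _ _ hx hy => rw [mul_pow]; exact mul_mem hx hy

theorem isInfinitesimal_iff {p : ℕ} [Fact p.Prime] {K H : Type u} [Field K] [CommRing H]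
    [HopfAlgebra K H] [Algebra.FiniteType K H] :
    IsInfinitesimal K H ↔ ∃ e : ℕ, ∀ x ∈ augmentationIdeal K H, x ^ p ^ e = 0 := by
  constructor
  · rintro ⟨_, k, hk⟩
    -- The nilpotency index `k` itself works as exponent, because `k < p ^ k`.
    refine ⟨k, fun x hx => pow_eq_zero_of_le
      (Nat.lt_pow_self (Fact.out : p.Prime).one_lt).le ?_⟩
    simpa [hk] using Ideal.pow_mem_pow hx k
  · rintro ⟨e, he⟩
    -- Each `x` is a scalar plus a nilpotent, hence integral. With finite type this gives
    -- finiteness, and a nil ideal of a Noetherian ring is nilpotent.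
    have hint : Algebra.IsIntegral K H := ⟨fun x => by
      have h1 : x - algebraMap K H (Bialgebra.counitAlgHom K H x) ∈ augmentationIdeal K H := by
        change Bialgebra.counitAlgHom K H _ = 0
        rw [map_sub, AlgHom.commutes]
        exact sub_self _
      have h2 : IsIntegral K (x - algebraMap K H (Bialgebra.counitAlgHom K H x)) :=
        .of_pow (pow_pos (Fact.out : p.Prime).pos e) (by rw [he _ h1]; exact isIntegral_zero)
      have h3 := h2.add (isIntegral_algebraMap (x := Bialgebra.counitAlgHom K H x))
      rwa [sub_add_cancel] at h3⟩
    have := Algebra.FiniteType.isNoetherianRing K H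
    refine ⟨Algebra.IsIntegral.finite, ?_⟩
    exact (Ideal.FG.isNilpotent_iff_le_nilradical (IsNoetherian.noetherian _)).2
      fun x hx => ⟨_, he x hx⟩

end

end

theorem mainTheorem3 {p m n : ℕ} [Fact p.Prime]
    {F : Type u} [Field F] [CharP F p]
    (θ : IterativeDerivation m F) (hθ : θ.NonDegenerate) [PerfectField θ.constants]
    {R : Type u} [CommRing R] [Algebra F R] (θR : IDExtension θ R)
    (A : IDE θ n) (hR : θR.IsPPVRing A)
    (E : Type*) [Field E] [Algebra R E] [IsFractionRing R E]
    [Algebra F E] [IsScalarTower F R E] :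
    (∃ (H : Type u) (_ : CommRing H) (_ : HopfAlgebra θ.constants H),
      Algebra.FiniteType θ.constants H ∧ Nonempty (θR.GaloisGroupScheme H)) ∧
    ∀ (H : Type u) [CommRing H] [HopfAlgebra θ.constants H], θR.GaloisGroupScheme H →
      (IsPurelyInseparable F E ↔ IsInfinitesimal θ.constants H) ∧
      (IsPurelyInseparable F E →
        ∃ _ : IsPurelyInseparable.HasExponent F E,
          IsHeight p θ.constants H (IsPurelyInseparable.exponent F E)) := by
  obtain ⟨Y, hY1, hY2⟩ := hR.exists_fundamental
  have hY : θR.IsGeneratedBy A Y := ⟨hY1, hY2⟩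
  refine ⟨⟨IDExtension.torsorAlgebra θ Y, inferInstance, IDExtension.torsorHopfAlgebra hR hY,
    inferInstanceAs (Algebra.FiniteType θ.constants (IDExtension.torsorAlgebra θ Y)),
    ⟨IDExtension.torsorGaloisGroupScheme hR hY⟩⟩, fun H _ _ 𝒢 => ?_⟩
  obtain ⟨α, hα⟩ := 𝒢.exists_algEquiv hR hY
  have : Algebra.FiniteType θ.constants H :=
    Algebra.FiniteType.equiv inferInstance α.symm
  have : Algebra.FiniteType F R :=
    ⟨Subalgebra.fg_def.2 ⟨_, (Set.finite_range _).union (Set.finite_singleton _), hY2⟩⟩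
  -- The two sets of admissible exponents coincide, so their least elements do too.
  have key : ∀ e : ℕ, (∀ x : E, x ^ p ^ e ∈ (algebraMap F E).range) ↔
      ∀ x ∈ augmentationIdeal θ.constants H, x ^ p ^ e = 0 := fun e => by
    rw [IDExtension.pow_eq_zero_iff_pow_mem_range hR hY α hα]
    exact (IsFractionRing.forall_pow_mem_range_iff _).symm
  have hexp : IsPurelyInseparable F E → IsPurelyInseparable.HasExponent F E := fun _ =>
    (IsPurelyInseparable.hasExponent_iff' F E p).2
      (IsPurelyInseparable.exists_forall_pow_mem_range (R := R) p)
  refine ⟨⟨fun h => ?_, fun h => ?_⟩, fun h => ⟨hexp h, ?_⟩⟩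
  · obtain ⟨e, he⟩ := (IsPurelyInseparable.hasExponent_iff' F E p).1 (hexp h)
    exact (isInfinitesimal_iff (p := p)).2 ⟨e, (key e).1 he⟩
  · obtain ⟨e, he⟩ := (isInfinitesimal_iff (p := p)).1 h
    have := (IsPurelyInseparable.hasExponent_iff' F E p).2 ⟨e, (key e).2 he⟩
    infer_instance
  · have := hexp h
    refine ⟨(key _).1 fun x => IsPurelyInseparable.exponent_def' F p x, fun e he => ?_⟩
    by_contra! hlt
    obtain ⟨x, hx⟩ := IsPurelyInseparable.exponent_min' p hlt
    exact hx ((key e).2 he x)
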